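/- Let $G$ be a group (considered as a discrete space), and let $\beta G$ be the Stone–Čech compactification of $G$: the set of all ultrafilters on $G$ with the topology whose basic open sets are $\{p\in\beta G: A\in p\}$, $A\subseteq G$. Let $G^*\subseteq\beta G$ be the set of nonprincipal ultrafilters, and for $A\subseteq G$ put $A^*=\{p\in G^*: A\in p\}$. For $g\in G$ and $p\in\beta G$ let $gp=\{gP: P\in p\}$. For $p\in G^*$ the $p$-companion of $A$ is $$\Delta_p(A)=A^*\cap\{gp: g\in G\},$$ and the ultracompanions of $A$ are the sets $\Delta_p(A)$ with $p\in G^*$. For a finite $F\subseteq G$ and $X\subseteq G$, $g\in G$, let $B_X(g,F)=X\cap(Fg\cup\{g\})$, and for $X'\subseteq X$ let $B_X(X',F)=\bigcup_{x\in X'}B_X(x,F)$. For groups $G,H$ and subsets $X\subseteq G$, $Y\subseteq H$, a map $f:X\to Y$ is a $\prec$-mapping if for every finite $F\subseteq G$ there is a finite $K\subseteq H$ with $f(B_X(x,F))\subseteq B_Y(f(x),K)$ for all $x\in X$; $X$ and $Y$ are asymorphic if there is a bijection $f:X\to Y$ such that $f$ and $f^{-1}$ are $\prec$-mappings; and $X$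 and $Y$ are coarsely equivalent if there are asymorphic subsets $X'\subseteq X$, $Y'\subseteq Y$ and finite sets $F\subseteq G$, $K\subseteq H$ with $X\subseteq B_X(X',F)$ and $Y\subseteq B_Y(Y',K)$. A piecewise shifted $IP$-set in $G$ is a set of the form $$\{g_{i_1}g_{i_2}\cdots g_{i_n}b_{i_n}: n\ge 1,\ 0\le i_1<i_2<\dots<i_n<\omega\},$$ where $(g_n)_{n<\omega}$ is an injective sequence in $G$ and $(b_n)_{n<\omega}$ is an arbitrary sequence in $G$. **Theorem.** For every subset $A$ of a group $G$ the following four statements are equivalent: (i) $A$ is scattered, i.e. for every infinite subset $Y$ of $A$ there is $p\in Y^*$ such that $\Delta_p(Y)$ is finite; (ii) $A$ is disparse, i.e. every ultracompanion of $A$ is discrete in the subspace topology inherited from $\beta G$; (iii) $A$ contains no subset coarsely equivalent to the group $\bigoplus_{\omega}\mathbb Z_2$; (iv) $A$ contains no piecewise shifted $IP$-set. -/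

import Mathlib

namespace ScatteredSubsets

/-- The remainder of the Stone-Čech compactification of the discrete set `G`: the nonprincipal
ultrafilters. The compactification itself is `Ultrafilter G` with Mathlib's topology, whose basic
open sets are `{p | A ∈ p}`. -/
def remainder (G : Type*) : Set (Ultrafilter G) :=
  {p | ∀ g : G, p ≠ pure g}

/-- `A^*`, the nonprincipal ultrafilters that contain `A`. -/
def starSet {G : Type*} (A : Set G) : Set (Ultrafilter G) :=
  {p | p ∈ remainder G ∧ A ∈ p}

/-- `g p`, the left translate of an ultrafilter by a group element. -/
def translate {G : Type*} [Group G] (g : G) (p : Ultrafilter G) : Ultrafilter G :=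
  p.map (fun x => g * x)

/-- The `p`-companion of `A`: the intersection of `A^*` with the orbit `G p`. -/
def companion {G : Type*} [Group G] (p : Ultrafilter G) (A : Set G) : Set (Ultrafilter G) :=
  starSet A ∩ Set.range (fun g : G => translate g p)

/-- `S` is an ultracompanion of `A` if it is the `p`-companion of `A` for a nonprincipal `p`. -/
def IsUltracompanion {G : Type*} [Group G] (A : Set G) (S : Set (Ultrafilter G)) : Prop :=
  ∃ p ∈ remainder G, S = companion p A

/-- Every ultracompanion is discrete in the subspace topology. -/
def IsDisparse {G : Type*} [Group G] (A : Set G) : Prop :=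
  ∀ S : Set (Ultrafilter G), IsUltracompanion A S → DiscreteTopology S

/-- Every infinite `Y ⊆ A` has a finite `p`-companion for some `p ∈ Y^*`. -/
def IsScattered {G : Type*} [Group G] (A : Set G) : Prop :=
  ∀ Y : Set G, Y ⊆ A → Y.Infinite → ∃ p ∈ starSet Y, (companion p Y).Finite

/-- The ball `F g ∪ {g}` of radius `F` around `g`. -/
def ball {G : Type*} [Group G] (g : G) (F : Finset G) : Set G :=
  (fun f => f * g) '' (F : Set G) ∪ {g}

/-- The ball of radius `F` around `g` in the subset `Y`. -/
def ballIn {G : Type*} [Group G] (Y : Set G) (g : G) (F : Finset G) : Set G :=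
  Y ∩ ball g F

/-- `≺`-mappings between subsets of groups: for each finite `F` there is a finite `K` such that
`f` maps the `F`-ball in `X` around any `x` into the `K`-ball in `Y` around `f x`. -/
def IsPrecMap {G H : Type*} [Group G] [Group H] {X : Set G} {Y : Set H} (f : X → Y) : Prop :=
  ∀ F : Finset G, ∃ K : Finset H, ∀ x x' : X,
    (x' : G) ∈ ballIn X (x : G) F → (f x' : H) ∈ ballIn Y (f x : H) K

/-- Bijections that are `≺`-mappings in both directions. -/
def IsAsymorphism {G H : Type*} [Group G] [Group H] {X : Set G} {Y : Set H}
    (e : X ≃ Y) : Prop :=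
  IsPrecMap e ∧ IsPrecMap e.symm

/-- `X'` is a large subset of `X`: it is contained in `X`, and `X` is covered by balls in `X` of
one finite radius around the points of `X'`. -/
def IsLargeIn {G : Type*} [Group G] (X' X : Set G) : Prop :=
  X' ⊆ X ∧ ∃ F : Finset G, X ⊆ ⋃ x ∈ X', ballIn X x F

/-- Subsets of groups are coarsely equivalent if they have asymorphic large subsets. -/
def CoarselyEquivalent {G H : Type*} [Group G] [Group H] (X : Set G) (Y : Set H) : Prop :=
  ∃ (X' : Set G) (Y' : Set H), IsLargeIn X' X ∧ IsLargeIn Y' Y ∧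
    ∃ e : X' ≃ Y', IsAsymorphism e

/-- The direct sum of countably many copies of the group of order two, written multiplicatively. -/
abbrev BooleanSum : Type := Multiplicative (ℕ →₀ ZMod 2)

/-- The set of all `g (i 0) * ... * g (i n) * b (i n)` with `i 0 < ... < i n`. -/
def shiftedProducts {G : Type*} [Group G] (g b : ℕ → G) : Set G :=
  {x | ∃ (n : ℕ) (i : Fin (n + 1) → ℕ), StrictMono i ∧
    x = (List.ofFn (fun k => g (i k))).prod * b (i (Fin.last n))}

/-- Piecewise shifted IP-sets: the sequence `g` is injective, the sequence `b` is arbitrary. -/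
def IsPiecewiseShiftedIP {G : Type*} [Group G] (S : Set G) : Prop :=
  ∃ g b : ℕ → G, Function.Injective g ∧ S = shiftedProducts g b

end ScatteredSubsets

namespace ScatteredSubsets

open Filter Topology

/-! ### Companions and minimal invariant sets: (ii) implies (i) -/

section Ultrafilters

variable {G : Type*}

/-! The proof is the cycle (ii) → (i) → (iii) → (iv) → (ii). If all companions of an infinite `Y ⊆
A` were infinite, a minimal closed invariant subset of `Y^*` would be infinite, and each of its
points would have a dense companion there; an accumulation point of it refutes discreteness
(`exists_minimal_invariant`). Finite companions pass through asymorphisms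
(`companion_finite_of_isPrecMap_symm`), but a large subset of the Boolean group has none, because
translation moves every ultrafilter freely. A piecewise shifted IP-set can be thinned to a cube
whose generators escape from finite sets of earlier data (`exists_isSparse`). Ratios of its points
then determine, up to finite error, where the index sets differ, which gives the coarse equivalence
(`IsSparse.coarselyEquivalent`). Finally, a point accumulated by its own companion yields an IP-set
by the recursion of `exists_shiftedProducts_subset_of_accPt`. -/

theorem isClosed_remainder : IsClosed (remainder G) := by
  have h : remainder G = ⋂ g : G, {p : Ultrafilter G | ({g}ᶜ : Set G) ∈ p} := by
    ext p
    simp only [remainder, Set.mem_ofPred_eq, Set.mem_iInter, Ultrafilter.compl_mem_iff_notMem]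
    refine forall_congr' fun g => not_congr ⟨?_, fun hg => ?_⟩
    · rintro rfl
      exact Set.mem_singleton g
    · obtain ⟨x, hx, rfl⟩ := Ultrafilter.eq_pure_of_finite_mem (Set.finite_singleton g) hg
      rw [Set.mem_singleton_iff.1 hx]
  rw [h]
  exact isClosed_iInter fun g => ultrafilter_isClosed_basic _

theorem isClosed_starSet (A : Set G) : IsClosed (starSet A) :=
  isClosed_remainder.inter (ultrafilter_isClosed_basic A)

theorem starSet_nonempty {A : Set G} (hA : A.Infinite) : (starSet A).Nonempty := by
  have := cofinite_inf_principal_neBot_iff.2 hA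
  have hle := Ultrafilter.of_le (cofinite ⊓ 𝓟 A)
  refine ⟨Ultrafilter.of (cofinite ⊓ 𝓟 A), fun g hg => ?_,
    hle (mem_inf_of_right (mem_principal_self A))⟩
  have h : ({g}ᶜ : Set G) ∈ Ultrafilter.of (cofinite ⊓ 𝓟 A) :=
    hle (mem_inf_of_left (Set.finite_singleton g).compl_mem_cofinite)
  rw [hg] at h
  exact h rfl

theorem starSet_mono {A B : Set G} (h : A ⊆ B) : starSet A ⊆ starSet B :=
  fun _ hp => ⟨hp.1, mem_of_superset hp.2 h⟩

variable [Group G]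

theorem mem_translate {g : G} {p : Ultrafilter G} {A : Set G} :
    A ∈ translate g p ↔ {x | g * x ∈ A} ∈ p := Iff.rfl

@[simp]
theorem translate_one (p : Ultrafilter G) : translate 1 p = p := by
  simp [translate]

theorem translate_translate (g h : G) (p : Ultrafilter G) :
    translate g (translate h p) = translate (g * h) p := by
  simp only [translate, Ultrafilter.map_map]
  congr 1
  funext x
  simp [mul_assoc]

theorem continuous_translate (g : G) : Continuous (translate g : Ultrafilter G → _) := by
  refine ultrafilterBasis_is_basis.continuous_iff.2 ?_
  rintro _ ⟨s, rfl⟩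
  exact ultrafilter_isOpen_basic _

theorem translate_mem_remainder {g : G} {p : Ultrafilter G} (hp : p ∈ remainder G) :
    translate g p ∈ remainder G := by
  intro h hg
  refine hp (g⁻¹ * h) ?_
  have := congrArg (translate g⁻¹) hg
  rw [translate_translate, inv_mul_cancel, translate_one] at this
  rw [this, translate, Ultrafilter.map_pure]

theorem mem_companion {p q : Ultrafilter G} {A : Set G} :
    q ∈ companion p A ↔ q ∈ starSet A ∧ ∃ g, translate g p = q := Iff.rfl

theorem self_mem_companion {p : Ultrafilter G} {A : Set G} (hp : p ∈ starSet A) :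
    p ∈ companion p A := ⟨hp, 1, translate_one p⟩

theorem companion_mono {p : Ultrafilter G} {A B : Set G} (h : A ⊆ B) :
    companion p A ⊆ companion p B :=
  Set.inter_subset_inter_left _ (starSet_mono h)

theorem companion_translate (g : G) (p : Ultrafilter G) (A : Set G) :
    companion (translate g p) A = companion p A := by
  ext q
  simp only [mem_companion, translate_translate]
  refine and_congr_right fun _ => ⟨fun ⟨h, hq⟩ => ⟨_, hq⟩, fun ⟨h, hq⟩ => ⟨h * g⁻¹, ?_⟩⟩
  rw [mul_assoc, inv_mul_cancel, mul_one, hq]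

/-- Any point of a companion can serve as its base point, so isolation need only be tested at `p`
itself. -/
theorem isDisparse_iff {A : Set G} :
    IsDisparse A ↔ ∀ p ∈ starSet A, ¬ AccPt p (𝓟 (companion p A)) := by
  constructor
  · intro h p hp hacc
    have := discreteTopology_subtype_iff.1 (h _ ⟨p, hp.1, rfl⟩) p (self_mem_companion hp)
    exact hacc.ne this
  · rintro h _ ⟨p, hp, rfl⟩
    refine discreteTopology_subtype_iff.2 fun q hq => ?_
    have hq' := h q hq.1
    obtain ⟨g, rfl⟩ := hq.2
    rw [companion_translate] at hq'
    exact not_neBot.1 hq'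

/-- The closure in `Y^*` of a companion is invariant under taking companions. -/
theorem companion_subset_closure {p q : Ultrafilter G} {Y : Set G}
    (hq : q ∈ closure (companion p Y)) : companion q Y ⊆ closure (companion p Y) := by
  rintro _ ⟨hr, g, rfl⟩
  rw [mem_closure_iff] at hq ⊢
  intro U hU hgU
  obtain ⟨x, ⟨hxU, hxY⟩, hx⟩ := hq (translate g ⁻¹' (U ∩ {r | Y ∈ r}))
    ((hU.inter (ultrafilter_isOpen_basic Y)).preimage (continuous_translate g)) ⟨hgU, hr.2⟩
  obtain ⟨h, rfl⟩ := hx.2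
  exact ⟨_, hxU, ⟨translate_mem_remainder hx.1.1, hxY⟩, g * h, (translate_translate ..).symm⟩

/-- Zorn's lemma with compactness gives a minimal nonempty closed set that contains the companions
of its points. The closure of any such companion is again a set of this kind, so it is everything.
-/
theorem exists_minimal_invariant {Y : Set G} (hY : Y.Infinite) :
    ∃ Z ⊆ starSet Y, IsClosed Z ∧ Z.Nonempty ∧
      ∀ p ∈ Z, closure (companion p Y) = Z := by
  let S : Set (Set (Ultrafilter G)) :=
    {Z | Z ⊆ starSet Y ∧ IsClosed Z ∧ Z.Nonempty ∧ ∀ p ∈ Z, companion p Y ⊆ Z}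
  obtain ⟨Z, hZ⟩ : ∃ Z, Minimal (· ∈ S) Z := by
    refine zorn_superset S fun c hc hchain => ?_
    rcases c.eq_empty_or_nonempty with rfl | hne
    · exact ⟨starSet Y, ⟨subset_rfl, isClosed_starSet Y, starSet_nonempty hY,
        fun p _ => Set.inter_subset_left⟩, by simp⟩
    · refine ⟨⋂₀ c, ⟨?_, isClosed_sInter fun Z hZ => (hc hZ).2.1, ?_, ?_⟩,
        fun s hs => Set.sInter_subset_of_mem hs⟩
      · obtain ⟨Z, hZ⟩ := hne
        exact (Set.sInter_subset_of_mem hZ).trans (hc hZ).1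
      · have := hne.to_subtype
        exact IsCompact.nonempty_sInter_of_directed_nonempty_isCompact_isClosed
          (fun U hU V hV => (hchain.total hU hV).elim
            (fun h => ⟨U, hU, subset_rfl, h⟩) (fun h => ⟨V, hV, h, subset_rfl⟩)) (fun U hU => (hc hU).2.2.1)
          (fun U hU => (hc hU).2.1.isCompact) (fun U hU => (hc hU).2.1)
      · exact fun p hp => Set.subset_sInter fun Z hZ => (hc hZ).2.2.2 p (hp Z hZ)
  obtain ⟨hZY, hZc, hZn, hZi⟩ := hZ.prop
  refine ⟨Z, hZY, hZc, hZn, fun p hp => ?_⟩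
  have hsub : closure (companion p Y) ⊆ Z := closure_minimal (hZi p hp) hZc
  refine hsub.antisymm (hZ.le_of_le ⟨hsub.trans hZY, isClosed_closure,
    ⟨p, subset_closure (self_mem_companion (hZY hp))⟩,
    fun q hq => companion_subset_closure hq⟩ hsub)

theorem IsDisparse.isScattered {A : Set G} (hA : IsDisparse A) : IsScattered A := by
  intro Y hYA hY
  by_contra! hinf
  obtain ⟨Z, hZY, hZc, ⟨p, hp⟩, hZ⟩ := exists_minimal_invariant hY
  have hZinf : Z.Infinite := by
    rw [← hZ p hp]
    exact Set.Infinite.mono subset_closure (hinf p (hZY hp))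
  obtain ⟨z, hz, hacc⟩ := hZinf.exists_accPt_of_subset_isCompact hZc.isCompact subset_rfl
  refine isDisparse_iff.1 hA z (starSet_mono hYA (hZY hz)) ?_
  rw [accPt_iff_nhds] at hacc ⊢
  intro U hU
  obtain ⟨V, hVU, hV, hzV⟩ := mem_nhds_iff.1 hU
  obtain ⟨y, ⟨hyV, hyZ⟩, hyz⟩ := hacc V (hV.mem_nhds hzV)
  -- The companion of `z` is dense in `Z`, so the nearby point `y ≠ z` can be replaced by a point of
  -- that companion.
  rw [← hZ z hz] at hyZ
  obtain ⟨x, ⟨hxV, hxz⟩, hx⟩ := mem_closure_iff.1 hyZ (V ∩ {z}ᶜ)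
    (hV.inter isOpen_compl_singleton) ⟨hyV, hyz⟩
  exact ⟨x, ⟨hVU hxV, companion_mono hYA hx⟩, hxz⟩

end Ultrafilters

/-! ### IP-sets from non-discrete companions: (iv) implies (ii) -/

section ShiftedProducts

variable {G : Type*} [Group G]

theorem exists_translate_of_accPt {A P : Set G} {p : Ultrafilter G}
    (hacc : AccPt p (𝓟 (companion p A))) (hP : P ∈ p) (T : Set G) (hT : T.Finite)
    (hTp : ∀ t ∈ T, translate t p ≠ p) :
    ∃ g, translate g p ≠ p ∧ P ∈ translate g p ∧ g ∉ T := by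
  rw [accPt_iff_nhds] at hacc
  have hU : {q : Ultrafilter G | P ∈ q} ∩ ((fun t => translate t p) '' T)ᶜ ∈ 𝓝 p := by
    refine ((ultrafilter_isOpen_basic P).inter
      (hT.image _).isClosed.isOpen_compl).mem_nhds ⟨hP, ?_⟩
    rintro ⟨t, ht, h⟩
    exact hTp t ht h
  obtain ⟨_, ⟨⟨hPg, hgT⟩, ⟨-, g, rfl⟩⟩, hg⟩ := hacc _ hU
  exact ⟨g, hg, hPg, fun h => hgT ⟨g, h, rfl⟩⟩

theorem exists_shiftedProducts_subset_of_accPt {A : Set G} {p : Ultrafilter G}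
    (hp : A ∈ p) (hacc : AccPt p (𝓟 (companion p A))) :
    ∃ g b : ℕ → G, Function.Injective g ∧ shiftedProducts g b ⊆ A := by
  classical
  -- The sequence consists of pairs `(g n, P n)` with `P n ∈ p` and `g n * P n ⊆ A ∩ ⋂ m < n, P m`.
  -- A product with increasing indices is then absorbed from the right, and `b n` may be any point
  -- of `P n`.
  obtain ⟨f, hf, hrel⟩ := exists_seq_of_forall_finset_exists
    (fun a : G × Set G => translate a.1 p ≠ p ∧ a.2 ∈ p ∧ ∀ x ∈ a.2, a.1 * x ∈ A)
    (fun a a' => a.1 ≠ a'.1 ∧ ∀ x ∈ a'.2, a'.1 * x ∈ a.2) (by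
      intro s hs
      have hP : A ∩ ⋂ a ∈ s, a.2 ∈ p :=
        inter_mem hp ((biInter_finset_mem s).2 fun a ha => (hs a ha).2.1)
      obtain ⟨g, hgp, hg, hgs⟩ := exists_translate_of_accPt hacc hP
        (s.image Prod.fst) (Finset.finite_toSet _) (by
          intro t ht
          obtain ⟨a, ha, rfl⟩ := Finset.mem_image.1 (Finset.mem_coe.1 ht)
          exact (hs a ha).1)
      refine ⟨(g, {x | g * x ∈ A ∩ ⋂ a ∈ s, a.2}), ⟨hgp, hg, fun x hx => hx.1⟩,
        fun a ha => ⟨?_, fun x hx => Set.mem_iInter₂.1 hx.2 a ha⟩⟩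
      rintro rfl
      exact hgs (Finset.mem_coe.2 (Finset.mem_image_of_mem _ ha)))
  have hne : ∀ n, (f n).2.Nonempty := fun n => p.nonempty_of_mem (hf n).2.1
  choose b hb using hne
  refine ⟨fun n => (f n).1, b, ?_, ?_⟩
  · intro m n hmn
    rcases lt_trichotomy m n with h | h | h
    · exact absurd hmn (hrel _ _ h).1
    · exact h
    · exact absurd hmn.symm (hrel _ _ h).1
  · rintro _ ⟨n, i, hi, rfl⟩
    have key : ∀ (n : ℕ) (i : Fin (n + 1) → ℕ), StrictMono i → ∀ x ∈ (f (i (Fin.last n))).2,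
        (List.ofFn fun k => (f (i k)).1).prod * x ∈ A := by
      intro n
      induction n with
      | zero =>
        intro i _ x hx
        simpa using (hf _).2.2 x hx
      | succ n ih =>
        intro i hi x hx
        rw [List.ofFn_succ', List.prod_concat, mul_assoc]
        exact ih (fun k => i k.castSucc) (hi.comp Fin.strictMono_castSucc) _
          ((hrel _ _ (hi (Fin.castSucc_lt_last _))).2 x hx)
    exact key n i hi _ (hb _)

theorem isDisparse_of_forall_not_isPiecewiseShiftedIP {A : Set G}
    (h : ¬ ∃ S : Set G, S ⊆ A ∧ IsPiecewiseShiftedIP S) : IsDisparse A := by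
  refine isDisparse_iff.2 fun p hp hacc => h ?_
  obtain ⟨g, b, hg, hS⟩ := exists_shiftedProducts_subset_of_accPt hp.2 hacc
  exact ⟨_, hS, g, b, hg, rfl⟩

end ShiftedProducts

/-! ### Companions under asymorphisms and in large subsets -/

section CoarseEquivalence

variable {G H : Type*} [Group G] [Group H]

theorem mem_ballIn_iff {Y : Set G} {g x : G} {F : Finset G} :
    x ∈ ballIn Y g F ↔ x ∈ Y ∧ ((∃ f ∈ F, f * g = x) ∨ x = g) := Iff.rfl

/-- Let `q` be the image of `p`. Pulling a translate `h q` in `Y^*` back to `X` moves `p`-almost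
every point within a fixed finite ball, so by pigeonhole for ultrafilters it yields some `k p`. This
injects the companion of `q` into that of `p`. -/
theorem companion_finite_of_isPrecMap_symm {X : Set G} {Y : Set H} (e : X ≃ Y)
    (he : IsPrecMap e.symm) {p : Ultrafilter G} (hp : p ∈ starSet X)
    (hfin : (companion p X).Finite) : ∃ q ∈ starSet Y, (companion q Y).Finite := by
  classical
  -- The value `1` outside `X` or `Y` is irrelevant: the ultrafilters concerned contain these sets.
  let φ : G → H := fun x => if h : x ∈ X then e ⟨x, h⟩ else 1
  let ψ : H → G := fun y => if h : y ∈ Y then e.symm ⟨y, h⟩ else 1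
  have hφ : ∀ x (h : x ∈ X), φ x = e ⟨x, h⟩ := fun x h => dif_pos h
  have hψ : ∀ y (h : y ∈ Y), ψ y = e.symm ⟨y, h⟩ := fun y h => dif_pos h
  have hφY : ∀ x ∈ X, φ x ∈ Y := fun x h => by rw [hφ x h]; exact (e _).2
  have hψφ : ∀ x ∈ X, ψ (φ x) = x := fun x h => by
    rw [hψ _ (hφY x h)]
    simp [hφ x h]
  have hψX : ∀ y ∈ Y, ψ y ∈ X := fun y h => by rw [hψ y h]; exact (e.symm _).2
  have hφψ : ∀ y ∈ Y, φ (ψ y) = y := fun y h => by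
    rw [hφ _ (hψX y h)]
    simp [hψ y h]
  have hpψ : Ultrafilter.map ψ (p.map φ) = p :=
    Ultrafilter.coe_injective (by
      rw [Ultrafilter.map_map, Ultrafilter.coe_map]
      refine Eq.trans (Filter.map_congr (m₂ := id) ?_) Filter.map_id
      filter_upwards [hp.2] with x hx using hψφ x hx)
  refine ⟨p.map φ, ⟨fun y hy => hp.1 (ψ y) ?_,
    Ultrafilter.mem_map.2 (mem_of_superset hp.2 hφY)⟩, ?_⟩
  · rw [← hpψ, hy, Ultrafilter.map_pure]
  refine Set.Finite.of_finite_image (f := Ultrafilter.map ψ) (hfin.subset ?_) ?_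
  · rintro _ ⟨_, ⟨⟨-, hY⟩, h, rfl⟩, rfl⟩
    obtain ⟨K, hK⟩ := he {h}
    have hev : ∀ᶠ x in (p : Filter G), ∃ k ∈ (↑(insert 1 K) : Set G), ψ (h * φ x) = k * x := by
      filter_upwards [hp.2, hY] with x hx hxY
      have := hK ⟨φ x, hφY x hx⟩ ⟨h * φ x, hxY⟩ ⟨hxY, Or.inl ⟨h, by simp, rfl⟩⟩
      rw [← hψ, ← hψ, hψφ x hx, mem_ballIn_iff] at this
      rcases this.2 with ⟨k, hk, hkx⟩ | hx1
      · exact ⟨k, by simp [hk], hkx.symm⟩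
      · exact ⟨1, by simp, by rw [one_mul, hx1]⟩
    obtain ⟨k, -, hk⟩ := (Ultrafilter.eventually_exists_mem_iff (Finset.finite_toSet _)).1 hev
    have heq : Ultrafilter.map ψ (translate h (p.map φ)) = translate k p :=
      Ultrafilter.coe_injective (by
        simp only [translate, Ultrafilter.map_map, Ultrafilter.coe_map]
        exact Filter.map_congr hk)
    refine ⟨⟨?_, Ultrafilter.mem_map.2 (mem_of_superset hY hψX)⟩, k, heq.symm⟩
    rw [heq]
    exact translate_mem_remainder hp.1
  · intro q hq r hr hqr
    have key : ∀ q ∈ starSet Y, Ultrafilter.map φ (Ultrafilter.map ψ q) = q := fun q hq =>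
      Ultrafilter.coe_injective (by
        rw [Ultrafilter.map_map, Ultrafilter.coe_map]
        refine Eq.trans (Filter.map_congr (m₂ := id) ?_) Filter.map_id
        filter_upwards [hq.2] with y hy using hφψ y hy)
    rw [← key q hq.1, hqr, key r hr.1]

theorem IsLargeIn.infinite [Infinite H] {Y : Set H} (hY : IsLargeIn Y Set.univ) :
    Y.Infinite := by
  obtain ⟨-, F, hF⟩ := hY
  intro hfin
  refine Set.infinite_univ (α := H) ((hfin.biUnion fun x _ => ?_).subset hF)
  exact (((Finset.finite_toSet F).image _).union (Set.finite_singleton x)).subset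
    Set.inter_subset_right

/-- Finitely many left translates of `Y` cover `H`, so for each `g` one of them lies in `g q`. Hence
finitely many translates of the set in question cover `H`. -/
theorem IsLargeIn.infinite_setOf_mem_translate [Infinite H] {Y : Set H}
    (hY : IsLargeIn Y Set.univ) (q : Ultrafilter H) :
    {h | Y ∈ translate h q}.Infinite := by
  classical
  obtain ⟨-, F, hF⟩ := hY
  intro hfin
  have hcov : ∀ g : H, ∃ f ∈ (↑(insert 1 F) : Set H), Y ∈ translate (f⁻¹ * g) q := by
    intro g
    refine (Ultrafilter.eventually_exists_mem_iff (f := q)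
      (P := fun f x => f⁻¹ * g * x ∈ Y) (Finset.finite_toSet _)).1 (Eventually.of_forall ?_)
    intro x
    obtain ⟨y, hy, hxy⟩ := Set.mem_iUnion₂.1 (hF (Set.mem_univ (g * x)))
    rcases hxy.2 with ⟨f, hf, hfy⟩ | h
    · refine ⟨f, Finset.mem_coe.2 (Finset.mem_insert_of_mem hf), ?_⟩
      rw [mul_assoc, ← hfy]
      simpa using hy
    · rw [Set.mem_singleton_iff] at h
      refine ⟨1, by simp, ?_⟩
      rw [mul_assoc, h]
      simpa using hy
  refine Set.infinite_univ (α := H) (((Finset.finite_toSet (insert 1 F)).biUnion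
    fun f _ => hfin.image (f * ·)).subset fun g _ => ?_)
  obtain ⟨f, hf, hfg⟩ := hcov g
  exact Set.mem_biUnion hf ⟨f⁻¹ * g, hfg, by simp⟩

end CoarseEquivalence

/-! ### The Boolean group: (i) implies (iii) -/

section BooleanSum

/-- At a coordinate where `g` and `h` differ, the two translations send each point to opposite
halves of the group, so `g q` and `h q` are separated by a half. -/
theorem BooleanSum.translate_injective (q : Ultrafilter BooleanSum) :
    Function.Injective fun h => translate h q := by
  intro g h hgh
  by_contra hne
  obtain ⟨n, hn⟩ : ∃ n, g.toAdd n ≠ h.toAdd n := by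
    by_contra! hall
    exact hne (Multiplicative.toAdd.injective (Finsupp.ext hall))
  let s : Set BooleanSum := {x | x.toAdd n = 0}
  have hs : {x | h * x ∈ s} = {x | g * x ∈ s}ᶜ := by
    ext x
    change h.toAdd n + x.toAdd n = 0 ↔ ¬ (g.toAdd n + x.toAdd n = 0)
    generalize h.toAdd n = a at *
    generalize g.toAdd n = b at *
    generalize x.toAdd n = c
    revert a b c
    decide
  have h1 : {x | g * x ∈ s} ∈ q ↔ {x | h * x ∈ s} ∈ q := by
    rw [← mem_translate, ← mem_translate]
    exact iff_of_eq (congrArg (s ∈ ·) hgh)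
  rw [hs, Ultrafilter.compl_mem_iff_notMem] at h1
  tauto

instance : Infinite BooleanSum :=
  inferInstanceAs (Infinite (ℕ →₀ ZMod 2))

theorem companion_infinite_of_isLargeIn {Y : Set BooleanSum} (hY : IsLargeIn Y Set.univ)
    {q : Ultrafilter BooleanSum} (hq : q ∈ remainder BooleanSum) : (companion q Y).Infinite := by
  refine ((hY.infinite_setOf_mem_translate q).image
    (BooleanSum.translate_injective q).injOn).mono ?_
  rintro _ ⟨h, hh, rfl⟩
  exact ⟨⟨translate_mem_remainder hq, hh⟩, h, rfl⟩

theorem IsScattered.not_coarselyEquivalent {G : Type*} [Group G] {A : Set G}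
    (hA : IsScattered A) :
    ¬ ∃ Y : Set G, Y ⊆ A ∧ CoarselyEquivalent Y (Set.univ : Set BooleanSum) := by
  rintro ⟨Y, hYA, X', Y', hX', hY', e, -, he⟩
  have hinf : X'.Infinite := by
    have := hY'.infinite.to_subtype
    exact Set.infinite_coe_iff.1 (e.infinite_iff.2 this)
  obtain ⟨p, hp, hfin⟩ := hA X' (hX'.1.trans hYA) hinf
  obtain ⟨q, hq, hqfin⟩ := companion_finite_of_isPrecMap_symm e he hp hfin
  exact companion_infinite_of_isLargeIn hY' hq.1 hqfin

end BooleanSum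

/-! ### Increasing products and escaping blocks -/

theorem exists_ge_apply_notMem {α : Type*} {g : ℕ → α} (hg : Function.Injective g) (N : ℕ) {T : Set α}
    (hT : T.Finite) : ∃ n ≥ N, g n ∉ T := by
  by_contra! h
  exact (Set.Ici_infinite N) ((hT.preimage hg.injOn).subset fun n hn => h n hn)

theorem strictMono_snoc {k n m : ℕ} {i : Fin k → ℕ} (hi : StrictMono i) (hlt : ∀ j, i j < n)
    (hnm : n ≤ m) : StrictMono (Fin.snoc i m : Fin (k + 1) → ℕ) := by
  intro a b hab
  induction b using Fin.lastCases with
  | last =>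
    induction a using Fin.lastCases with
    | last => exact absurd hab (lt_irrefl _)
    | cast a => simpa using (hlt a).trans_le hnm
  | cast b =>
    induction a using Fin.lastCases with
    | last => exact absurd (hab.trans (Fin.castSucc_lt_last b)) (lt_irrefl _)
    | cast a => simpa using hi (Fin.castSucc_lt_castSucc_iff.1 hab)

section Blocks

variable {G : Type*} [Group G]

/-- `w` is a product of terms of `g` with increasing indices below `n`. -/
def IsIncreasingProduct (g : ℕ → G) (n : ℕ) (w : G) : Prop :=
  ∃ (k : ℕ) (i : Fin k → ℕ), StrictMono i ∧ (∀ j, i j < n) ∧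
    w = (List.ofFn fun j => g (i j)).prod

theorem isIncreasingProduct_zero (g : ℕ → G) : IsIncreasingProduct g 0 1 :=
  ⟨0, Fin.elim0, fun a => a.elim0, fun a => a.elim0, by simp⟩

theorem IsIncreasingProduct.mono {g : ℕ → G} {m n : ℕ} {w : G}
    (h : IsIncreasingProduct g m w) (hmn : m ≤ n) : IsIncreasingProduct g n w := by
  obtain ⟨k, i, hi, hlt, rfl⟩ := h
  exact ⟨k, i, hi, fun j => (hlt j).trans_le hmn, rfl⟩

theorem prod_ofFn_snoc (g : ℕ → G) {k : ℕ} (i : Fin k → ℕ) (m : ℕ) :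
    (List.ofFn fun j => g ((Fin.snoc i m : Fin (k + 1) → ℕ) j)).prod =
      (List.ofFn fun j => g (i j)).prod * g m := by
  rw [List.ofFn_succ', List.prod_concat]
  simp

theorem IsIncreasingProduct.mul {g : ℕ → G} {n m : ℕ} {w : G}
    (h : IsIncreasingProduct g n w) (hnm : n ≤ m) :
    IsIncreasingProduct g (m + 1) (w * g m) := by
  obtain ⟨k, i, hi, hlt, rfl⟩ := h
  refine ⟨k + 1, Fin.snoc i m, strictMono_snoc hi hlt hnm, fun j => ?_,
    (prod_ofFn_snoc g i m).symm⟩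
  induction j using Fin.lastCases with
  | last => simp
  | cast j => simpa using ((hlt j).trans_le hnm).trans (Nat.lt_succ_self m)

theorem IsIncreasingProduct.mul_mem_shiftedProducts {g : ℕ → G} (b : ℕ → G) {n m : ℕ} {w : G}
    (h : IsIncreasingProduct g n w) (hnm : n ≤ m) :
    w * g m * b m ∈ shiftedProducts g b := by
  obtain ⟨k, i, hi, hlt, rfl⟩ := h
  refine ⟨k, Fin.snoc i m, strictMono_snoc hi hlt hnm, ?_⟩
  rw [prod_ofFn_snoc, Fin.snoc_last]

/-- Beyond any index there is a block of one or two terms of the sequence whose product `u`, and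
whose shifted product `u * c`, both avoid a given finite set. -/
theorem exists_block {g : ℕ → G} (hg : Function.Injective g) (b : ℕ → G) (N : ℕ) {T : Set G}
    (hT : T.Finite) : ∃ (N' : ℕ) (u c : G), u ∉ T ∧ u * c ∉ T ∧
      ∀ w, (IsIncreasingProduct g N w → IsIncreasingProduct g N' w) ∧
        (IsIncreasingProduct g N w → IsIncreasingProduct g N' (w * u)) ∧
        (IsIncreasingProduct g N w → w * u * c ∈ shiftedProducts g b) := by
  classical
  by_cases h : ∃ n ≥ N, g n ∉ T ∧ g n * b n ∉ T
  · obtain ⟨n, hn, h1, h2⟩ := h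
    exact ⟨n + 1, g n, b n, h1, h2, fun w => ⟨fun hw => hw.mono (by omega),
      fun hw => hw.mul hn, fun hw => hw.mul_mem_shiftedProducts b hn⟩⟩
  -- Now `g n ∉ T` forces `g n * b n ∈ T` for `n ≥ N`. Prefixing a term `g m` outside `T * T⁻¹`
  -- pushes the shifted product out of `T`.
  · push Not at h
    obtain ⟨m, hm, hmT⟩ := exists_ge_apply_notMem hg N
      (hT.image2 (fun x y => x * y⁻¹) hT)
    obtain ⟨n, hn, hnT⟩ := exists_ge_apply_notMem hg (m + 1)
      (hT.union (hT.image fun x => (g m)⁻¹ * x))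
    have hnb := h n (by omega) fun h => hnT (Or.inl h)
    refine ⟨n + 1, g m * g n, b n, fun hmn => hnT (Or.inr ⟨_, hmn, by group⟩),
      fun hmn => hmT ⟨_, hmn, _, hnb, by group⟩, fun w => ⟨fun hw => hw.mono (by omega),
        fun hw => ?_, fun hw => ?_⟩⟩
    · rw [← mul_assoc]
      exact (hw.mul hm).mul hn
    · rw [← mul_assoc]
      exact (hw.mul hm).mul_mem_shiftedProducts b hn

end Blocks

/-! ### Sparse cubes inside piecewise shifted IP-sets -/

section Cube

variable {G : Type*} [Group G]

/-- The product, in increasing order, of the `u i` with `i ∈ I` and `i < n`. -/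
def partialProd (u : ℕ → G) (I : Finset ℕ) : ℕ → G
  | 0 => 1
  | n + 1 => if n ∈ I then partialProd u I n * u n else partialProd u I n

/-- The point `u (i 0) * ... * u (i n) * c (i n)` of the cube for `I = {i 0 < ... < i n}`. -/
def cubePoint (u c : ℕ → G) (I : Finset ℕ) : G :=
  partialProd u I (I.sup id) * u (I.sup id) * c (I.sup id)

theorem cubePoint_eq {u c : ℕ → G} {I : Finset ℕ} {m : ℕ} (hm : m ∈ I) (hle : ∀ i ∈ I, i ≤ m) :
    cubePoint u c I = partialProd u I m * u m * c m := by
  have : I.sup id = m := le_antisymm (Finset.sup_le hle) (Finset.le_sup (f := id) hm)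
  rw [cubePoint, this]

/-- The common factors stand on the right of both products and cancel. -/
theorem partialProd_mul_inv_eq {u : ℕ → G} {I J : Finset ℕ} {k n : ℕ} (hkn : k ≤ n)
    (h : ∀ i, k ≤ i → (i ∈ J ↔ i ∈ I)) :
    partialProd u J n * (partialProd u I n)⁻¹ = partialProd u J k * (partialProd u I k)⁻¹ := by
  induction n, hkn using Nat.le_induction with
  | base => rfl
  | succ n hn ih =>
    by_cases hI : n ∈ I
    · simp only [partialProd, if_pos hI, if_pos ((h n hn).2 hI), ← ih]
      group
    · simp only [partialProd, if_neg hI, if_neg (mt (h n hn).1 hI), ih]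

/-- Two sequences generating a cube, with finite sets `E k` that contain what the first `k` terms
produce, such that the `k`-th term escapes from `E k`. -/
structure IsSparse (u c : ℕ → G) (E : ℕ → Finset G) : Prop where
  one_mem : 1 ∈ E 0
  mem_succ : ∀ k, ∀ e ∈ E k, e ∈ E (k + 1)
  mul_mem_succ : ∀ k, ∀ e ∈ E k, e * u k ∈ E (k + 1)
  mul_mul_mem_succ : ∀ k, ∀ e ∈ E k, e * u k * c k ∈ E (k + 1)
  ne : ∀ k, ∀ e₁ ∈ E k, ∀ e₂ ∈ E k, ∀ e₃ ∈ E k, ∀ e₄ ∈ E k,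
    u k ≠ e₁⁻¹ * (e₂ * e₃⁻¹ * e₄)
  mul_ne : ∀ k, ∀ e₁ ∈ E k, ∀ e₂ ∈ E k, ∀ e₃ ∈ E k, ∀ e₄ ∈ E k,
    u k * c k ≠ e₁⁻¹ * (e₂ * e₃⁻¹ * e₄)

/-- Iterate `exists_block`, carrying an index bound and the finite set `E k`; the set to avoid
consists of the words `e₁⁻¹ * (e₂ * e₃⁻¹ * e₄)` over `E k`. -/
theorem exists_isSparse {g : ℕ → G} (hg : Function.Injective g) (b : ℕ → G) :
    ∃ u c E, IsSparse u c E ∧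
      ∀ I : Finset ℕ, ∀ n, partialProd u I n * u n * c n ∈ shiftedProducts g b := by
  classical
  have hstep : ∀ s : ℕ × Finset G, ∃ (N' : ℕ) (u c : G),
      u ∉ (fun e : G × G × G × G => e.1⁻¹ * (e.2.1 * e.2.2.1⁻¹ * e.2.2.2)) ''
        ↑(s.2 ×ˢ s.2 ×ˢ s.2 ×ˢ s.2) ∧
      u * c ∉ (fun e : G × G × G × G => e.1⁻¹ * (e.2.1 * e.2.2.1⁻¹ * e.2.2.2)) ''
        ↑(s.2 ×ˢ s.2 ×ˢ s.2 ×ˢ s.2) ∧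
      ∀ w, (IsIncreasingProduct g s.1 w → IsIncreasingProduct g N' w) ∧
        (IsIncreasingProduct g s.1 w → IsIncreasingProduct g N' (w * u)) ∧
        (IsIncreasingProduct g s.1 w → w * u * c ∈ shiftedProducts g b) :=
    fun s => exists_block hg b s.1 ((Finset.finite_toSet _).image _)
  choose N' u c hu huc hw using hstep
  let s : ℕ → ℕ × Finset G := fun n => Nat.rec (0, {1}) (fun _ s =>
    (N' s, s.2 ∪ s.2.image (· * u s) ∪ s.2.image (· * u s * c s))) n
  have hs : ∀ k, s (k + 1) = (N' (s k), (s k).2 ∪ (s k).2.image (· * u (s k)) ∪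
    (s k).2.image (· * u (s k) * c (s k))) := fun k => rfl
  refine ⟨fun k => u (s k), fun k => c (s k), fun k => (s k).2, ⟨?_, ?_, ?_, ?_, ?_, ?_⟩, ?_⟩
  · exact Finset.mem_singleton_self 1
  · intro k e he
    rw [hs]
    simp [he]
  · intro k e he
    rw [hs]
    exact Finset.mem_union_left _ (Finset.mem_union_right _ (Finset.mem_image_of_mem _ he))
  · intro k e he
    rw [hs]
    exact Finset.mem_union_right _ (Finset.mem_image_of_mem (· * u (s k) * c (s k)) he)
  · intro k e₁ h₁ e₂ h₂ e₃ h₃ e₄ h₄ h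
    exact hu (s k) ⟨(e₁, e₂, e₃, e₄), by simp [h₁, h₂, h₃, h₄], h.symm⟩
  · intro k e₁ h₁ e₂ h₂ e₃ h₃ e₄ h₄ h
    exact huc (s k) ⟨(e₁, e₂, e₃, e₄), by simp [h₁, h₂, h₃, h₄], h.symm⟩
  · intro I n
    refine (hw (s n) _).2.2 ?_
    induction n with
    | zero => exact isIncreasingProduct_zero g
    | succ n ih =>
      rw [hs, partialProd]
      split_ifs
      · exact (hw (s n) _).2.1 ih
      · exact (hw (s n) _).1 ih

namespace IsSparse

variable {u c : ℕ → G} {E : ℕ → Finset G}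

theorem mono (h : IsSparse u c E) {k l : ℕ} (hkl : k ≤ l) : E k ⊆ E l := by
  induction l, hkl using Nat.le_induction with
  | base => exact subset_rfl
  | succ l _ ih => exact fun e he => h.mem_succ l e (ih he)

theorem partialProd_mem (h : IsSparse u c E) (I : Finset ℕ) (k : ℕ) : partialProd u I k ∈ E k := by
  induction k with
  | zero => exact h.one_mem
  | succ k ih =>
    rw [partialProd]
    split_ifs
    · exact h.mul_mem_succ k _ ih
    · exact h.mem_succ k _ ih

theorem cubePoint_mem (h : IsSparse u c E) {I : Finset ℕ} (hI : I.Nonempty) {k : ℕ} (hk : ∀ i ∈ I, i < k) :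
    cubePoint u c I ∈ E k := by
  rw [cubePoint_eq (I.max'_mem hI) (I.le_max')]
  exact h.mono (hk _ (I.max'_mem hI)) (h.mul_mul_mem_succ _ _ (h.partialProd_mem I _))

/-- Either both index sets lie below `k`, and both points are in `E k`, or the maxima agree and the
common tails cancel, leaving a ratio of partial products. -/
theorem exists_mul_inv_eq (h : IsSparse u c E) {I J : Finset ℕ} (hI : I.Nonempty) (hJ : J.Nonempty) {k : ℕ}
    (hIJ : ∀ i, k ≤ i → (i ∈ J ↔ i ∈ I)) :
    ∃ e ∈ E k, ∃ e' ∈ E k, cubePoint u c J = e * e'⁻¹ * cubePoint u c I := by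
  by_cases hk : ∀ i ∈ I, i < k
  · refine ⟨_, h.cubePoint_mem hJ fun i hi => ?_, _, h.cubePoint_mem hI hk, by group⟩
    by_contra! hki
    exact hki.not_gt (hk i ((hIJ i hki).1 hi))
  · push Not at hk
    obtain ⟨i, hi, hki⟩ := hk
    have hm := I.max'_mem hI
    have hkm : k ≤ I.max' hI := hki.trans (I.le_max' i hi)
    refine ⟨_, h.partialProd_mem J k, _, h.partialProd_mem I k, ?_⟩
    rw [← partialProd_mul_inv_eq hkm hIJ, cubePoint_eq hm I.le_max',
      cubePoint_eq ((hIJ _ hkm).2 hm) fun j hj => ?_]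
    · group
    · by_contra! hlt
      exact hlt.not_ge (I.le_max' j ((hIJ j (hkm.trans hlt.le)).1 hj))

/-- Equality could be solved for `u l * c l` if `l` is the maximum of `J`, and for `u l` after
cancelling common tails otherwise. The solution is a word that sparseness forbids. -/
theorem cubePoint_ne (h : IsSparse u c E) {I J : Finset ℕ} (hI : I.Nonempty) {l : ℕ} (hlJ : l ∈ J) (hlI : l ∉ I)
    (hIJ : ∀ i, l < i → (i ∈ J ↔ i ∈ I)) {e e' : G} (he : e ∈ E l) (he' : e' ∈ E l) :
    cubePoint u c J ≠ e * e'⁻¹ * cubePoint u c I := by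
  intro heq
  by_cases hl : ∀ i ∈ I, i < l
  · rw [cubePoint_eq hlJ] at heq
    · refine h.mul_ne l _ (h.partialProd_mem J l) _ he _ he' _ (h.cubePoint_mem hI hl) ?_
      rw [← heq]
      group
    · intro i hi
      by_contra! hli
      exact hli.not_gt (hl i ((hIJ i hli).1 hi))
  · push Not at hl
    obtain ⟨i, hi, hli⟩ := hl
    have hm := I.max'_mem hI
    have hlm : l + 1 ≤ I.max' hI :=
      ((lt_of_le_of_ne hli (by rintro rfl; exact hlI hi))).trans_le (I.le_max' i hi)
    have hle : ∀ j ∈ J, j ≤ I.max' hI := by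
      intro j hj
      by_contra! hlt
      exact hlt.not_ge (I.le_max' j ((hIJ j (by omega)).1 hj))
    have hratio := partialProd_mul_inv_eq (u := u) hlm fun i hi => hIJ i hi
    rw [cubePoint_eq hm I.le_max', cubePoint_eq ((hIJ _ hlm).2 hm) hle, ← mul_assoc,
      ← mul_assoc, mul_left_inj, mul_left_inj, ← mul_inv_eq_iff_eq_mul, hratio, partialProd,
      partialProd, if_pos hlJ, if_neg hlI] at heq
    refine h.ne l _ (h.partialProd_mem J l) _ he _ he' _ (h.partialProd_mem I l) ?_
    rw [← heq]
    group

/-- Apply `cubePoint_ne` at the largest index where the sets differ, inverting the relation if that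
index lies in `I`. With `e = e' = 1` this also gives injectivity of the cube. -/
theorem mem_iff_mem_of_eq (h : IsSparse u c E) {I J : Finset ℕ} (hI : I.Nonempty) (hJ : J.Nonempty) {k : ℕ}
    {e e' : G} (he : e ∈ E k) (he' : e' ∈ E k)
    (heq : cubePoint u c J = e * e'⁻¹ * cubePoint u c I) {i : ℕ} (hi : k ≤ i) :
    i ∈ J ↔ i ∈ I := by
  by_contra hne
  have hmem : ∀ j, j ∈ symmDiff I J ↔ ¬ (j ∈ J ↔ j ∈ I) := by
    intro j
    rw [Finset.mem_symmDiff]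
    tauto
  have hD : (symmDiff I J).Nonempty := ⟨i, (hmem i).2 hne⟩
  obtain ⟨l, hl, hmax⟩ : ∃ l ∈ symmDiff I J, ∀ j ∈ symmDiff I J, j ≤ l :=
    ⟨_, Finset.max'_mem _ hD, Finset.le_max' _⟩
  have hkl : k ≤ l := hi.trans (hmax i ((hmem i).2 hne))
  have hag : ∀ j, l < j → (j ∈ J ↔ j ∈ I) := by
    intro j hj
    by_contra hj'
    exact hj.not_ge (hmax j ((hmem j).2 hj'))
  rcases Finset.mem_symmDiff.1 hl with ⟨h1, h2⟩ | ⟨h1, h2⟩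
  · refine h.cubePoint_ne hJ h1 h2 (fun j hj => (hag j hj).symm) (h.mono hkl he')
      (h.mono hkl he) ?_
    rw [heq]
    group
  · exact h.cubePoint_ne hI h1 h2 hag (h.mono hkl he) (h.mono hkl he') heq

end IsSparse

end Cube

/-! ### Sparse cubes and the Boolean group: (iii) implies (iv) -/

section CoarseCube

namespace BooleanSum

/-- The support of an element of the Boolean group. -/
def supp (x : BooleanSum) : Finset ℕ := x.toAdd.support

theorem mem_supp {x : BooleanSum} {n : ℕ} : n ∈ supp x ↔ x.toAdd n ≠ 0 :=
  Finsupp.mem_support_iff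

theorem supp_nonempty_iff {x : BooleanSum} : (supp x).Nonempty ↔ x ≠ 1 := by
  rw [supp, Finsupp.support_nonempty_iff]
  rfl

theorem mem_supp_mul_inv_iff {x y : BooleanSum} {n : ℕ} :
    n ∈ supp (x * y⁻¹) ↔ ¬ (n ∈ supp x ↔ n ∈ supp y) := by
  simp only [mem_supp]
  change x.toAdd n + -(y.toAdd n) ≠ 0 ↔ _
  generalize x.toAdd n = a
  generalize y.toAdd n = b
  revert a b
  decide

theorem supp_injective : Function.Injective supp := by
  intro x y hxy
  by_contra hne
  obtain ⟨n, hn⟩ := supp_nonempty_iff.2 (mt mul_inv_eq_one.1 hne)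
  exact mem_supp_mul_inv_iff.1 hn (by rw [hxy])

theorem supp_surjective : Function.Surjective supp := by
  classical
  intro I
  refine ⟨Multiplicative.ofAdd (Finsupp.indicator I fun _ _ => 1), ?_⟩
  ext n
  simp [mem_supp, Finsupp.indicator_apply]

theorem finite_setOf_supp_lt (k : ℕ) : {x : BooleanSum | ∀ n ∈ supp x, n < k}.Finite := by
  refine Set.Finite.of_finite_image (f := supp) ?_ supp_injective.injOn
  refine (Finset.finite_toSet (Finset.range k).powerset).subset ?_
  rintro _ ⟨x, hx, rfl⟩
  exact Finset.mem_coe.2 (Finset.mem_powerset.2 fun n hn => Finset.mem_range.2 (hx n hn))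

/-- Cube points are indexed by nonempty sets, so the identity has to be discarded. -/
theorem isLargeIn_compl_one : IsLargeIn ({1}ᶜ : Set BooleanSum) Set.univ := by
  obtain ⟨a, ha⟩ := exists_ne (1 : BooleanSum)
  refine ⟨Set.subset_univ _, {a⁻¹}, fun x _ => ?_⟩
  by_cases hx : x = 1
  · exact Set.mem_biUnion ha ⟨trivial, Or.inl ⟨a⁻¹, by simp, by simp [hx]⟩⟩
  · exact Set.mem_biUnion hx ⟨trivial, Or.inr rfl⟩

end BooleanSum

variable {G : Type*} [Group G]

theorem isLargeIn_self (X : Set G) : IsLargeIn X X :=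
  ⟨subset_rfl, ∅, fun _ hx => Set.mem_biUnion hx ⟨hx, Or.inr rfl⟩⟩

open BooleanSum in
theorem IsSparse.coarselyEquivalent {u c : ℕ → G} {E : ℕ → Finset G} (h : IsSparse u c E) :
    CoarselyEquivalent {x | ∃ I : Finset ℕ, I.Nonempty ∧ cubePoint u c I = x}
      (Set.univ : Set BooleanSum) := by
  classical
  set X := {x | ∃ I : Finset ℕ, I.Nonempty ∧ cubePoint u c I = x}
  have hne : ∀ x : ({1}ᶜ : Set BooleanSum), (supp x.1).Nonempty :=
    fun x => supp_nonempty_iff.2 x.2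
  let f : ({1}ᶜ : Set BooleanSum) → X := fun x => ⟨cubePoint u c (supp x.1), _, hne x, rfl⟩
  have hf : Function.Bijective f := by
    constructor
    · intro x y hxy
      refine Subtype.ext (supp_injective (Finset.ext fun i => ?_))
      refine h.mem_iff_mem_of_eq (hne y) (hne x) h.one_mem h.one_mem ?_ (Nat.zero_le i)
      simpa using congrArg Subtype.val hxy
    · rintro ⟨_, I, hI, rfl⟩
      obtain ⟨x, rfl⟩ := supp_surjective I
      exact ⟨⟨x, supp_nonempty_iff.1 hI⟩, rfl⟩
  let e : ({1}ᶜ : Set BooleanSum) ≃ X := Equiv.ofBijective f hf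
  have he : ∀ x, (e x : G) = cubePoint u c (supp x.1) := fun x => rfl
  refine ⟨X, {1}ᶜ, isLargeIn_self X, isLargeIn_compl_one, e.symm, ?_, ?_⟩
  · intro F
    -- One pair realizing `a` writes it as a ratio of elements of `E k`; this `k` then serves every
    -- pair with the same ratio.
    have hbound : ∀ a : G, ∃ k, ∀ x y : ({1}ᶜ : Set BooleanSum), (e y : G) = a * e x →
        ∀ n, k ≤ n → (n ∈ supp y.1 ↔ n ∈ supp x.1) := by
      intro a
      by_cases ha : ∃ x y : ({1}ᶜ : Set BooleanSum), (e y : G) = a * e x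
      · obtain ⟨x, y, hxy⟩ := ha
        let k := (supp x.1 ∪ supp y.1).sup id + 1
        have hk : ∀ i ∈ supp x.1 ∪ supp y.1, i < k :=
          fun i hi => Nat.lt_succ_of_le (Finset.le_sup (f := id) hi)
        refine ⟨k, fun x' y' hxy' n hn => ?_⟩
        refine h.mem_iff_mem_of_eq (hne x') (hne y')
          (h.cubePoint_mem (hne y) fun i hi => hk i (Finset.mem_union_right _ hi))
          (h.cubePoint_mem (hne x) fun i hi => hk i (Finset.mem_union_left _ hi)) ?_ hn
        rw [← he, ← he, ← he, ← he, hxy, mul_inv_cancel_right, hxy']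
      · exact ⟨0, fun x y hxy => absurd ⟨x, y, hxy⟩ ha⟩
    choose k hk using hbound
    refine ⟨(finite_setOf_supp_lt (F.sup k)).toFinset, fun x y hxy => ⟨(e.symm y).2, ?_⟩⟩
    rcases hxy.2 with ⟨a, ha, hax⟩ | hyx
    · refine Or.inl ⟨(e.symm y : BooleanSum) * (e.symm x : BooleanSum)⁻¹, ?_, by simp⟩
      rw [Set.Finite.coe_toFinset]
      intro n hn
      by_contra! hkn
      refine mem_supp_mul_inv_iff.1 hn (hk a _ _ ?_ n ((Finset.le_sup ha).trans hkn))
      rw [e.apply_symm_apply, e.apply_symm_apply]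
      exact hax.symm
    · rw [Set.mem_singleton_iff] at hyx
      exact Or.inr (by rw [Subtype.ext hyx]; rfl)
  · intro F
    rw [e.symm_symm]
    -- Multiplying by an element of `F` changes only coordinates below this `k`.
    let k := (F.biUnion supp).sup id + 1
    refine ⟨(E k ×ˢ E k).image fun p => p.1 * p.2⁻¹, fun x y hxy => ⟨(e y).2, ?_⟩⟩
    rcases hxy.2 with ⟨a, ha, hax⟩ | hyx
    · left
      obtain ⟨b, hb, b', hb', hbb⟩ := h.exists_mul_inv_eq (hne x) (hne y) (k := k) (by
        intro i hi
        by_contra hne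
        rw [← mem_supp_mul_inv_iff, ← hax] at hne
        rw [mul_inv_cancel_right] at hne
        have : i ≤ (F.biUnion supp).sup id :=
          Finset.le_sup (f := id) (Finset.mem_biUnion.2 ⟨a, ha, hne⟩)
        omega)
      refine ⟨b * b'⁻¹, ?_, hbb.symm⟩
      exact Finset.mem_coe.2 (Finset.mem_image.2
        ⟨(b, b'), Finset.mem_product.2 ⟨hb, hb'⟩, rfl⟩)
    · rw [Set.mem_singleton_iff] at hyx
      exact Or.inr (by rw [Subtype.ext hyx]; rfl)

theorem IsPiecewiseShiftedIP.exists_coarselyEquivalent {S : Set G}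
    (hS : IsPiecewiseShiftedIP S) :
    ∃ Y ⊆ S, CoarselyEquivalent Y (Set.univ : Set BooleanSum) := by
  obtain ⟨g, b, hg, rfl⟩ := hS
  obtain ⟨u, c, E, h, hmem⟩ := exists_isSparse hg b
  refine ⟨_, ?_, h.coarselyEquivalent⟩
  rintro _ ⟨I, -, rfl⟩
  exact hmem I _

end CoarseCube

end ScatteredSubsets

theorem theorem1 {G : Type*} [Group G] (A : Set G) :
    List.TFAE [
      ScatteredSubsets.IsScattered A,
      ScatteredSubsets.IsDisparse A,
      ¬ ∃ Y : Set G, Y ⊆ A ∧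
        ScatteredSubsets.CoarselyEquivalent Y (Set.univ : Set ScatteredSubsets.BooleanSum),
      ¬ ∃ S : Set G, S ⊆ A ∧ ScatteredSubsets.IsPiecewiseShiftedIP S] := by
  tfae_have 2 → 1 := fun h => h.isScattered
  tfae_have 1 → 3 := fun h => h.not_coarselyEquivalent
  tfae_have 3 → 4 := by
    rintro h ⟨S, hSA, hS⟩
    obtain ⟨Y, hYS, hY⟩ := hS.exists_coarselyEquivalent
    exact h ⟨Y, hYS.trans hSA, hY⟩
  tfae_have 4 → 2 := fun h =>
    ScatteredSubsets.isDisparse_of_forall_not_isPiecewiseShiftedIP h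
  tfae_finish
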